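/- Let $X$ be a finite-dimensional real Hilbert space, let $S\subseteq X$, and let $F\colon S\to X$ be firmly nonexpansive, i.e., $\|Fx-Fy\|^2\le\langle Fx-Fy,\,x-y\rangle$ for all $x,y\in S$. Set $D:=\overline{\operatorname{conv}}\,\operatorname{ran}F$ (the closed convex hull of the range of $F$) and $Y:=\operatorname{span}D$, and assume that $0\in\operatorname{ri}D$, the relative interior of $D$. Let $P$ be the orthogonal projector from $X$ onto $Y$. A set-valued operator $A\colon H\rightrightarrows H$ on a real Hilbert space $H$ is *monotone* if $\langle x-y,x^*-y^*\rangle\ge 0$ whenever $x^*\in Ax$ and $y^*\in Ay$; it is *maximal monotone* if it is monotone and no operator whose graph properly contains the graph of $A$ is monotone. Sums and differences of operators are taken pointwise, $x\in A^{-1}x^*$ means $x^*\in Ax$, and $F^{-1}y=\{x\in S : Fx=y\}$. The normal cone operator $N_D\colon X\rightrightarrows X$ is given by $N_D(x)=\{x^*\in X : \langle d-x,x^*\rangle\le 0\ \text{for all } d\in D\}$ if $x\in D$, and $N_D(x)=\varnothing$ otherwise. Let $B\colon Y\rightrightarrows Y$ be an arbitrary maximal monotone operator whose graph contains the graph of $P(F^{-1}-\operatorname{Id})\colon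 Y\rightrightarrows Y$, $y\mapsto\{P(x-y) : x\in S,\ Fx=y\}$. Set $$\widehat B:=BP+N_D\colon X\rightrightarrows X,\qquad \widehat F:=(\operatorname{Id}+\widehat B)^{-1}.$$ Then $\widehat F$ is single-valued with full domain, i.e., a mapping $\widehat F\colon X\to X$; it is firmly nonexpansive on $X$; it extends $F$, i.e., $\widehat Fx=Fx$ for all $x\in S$; and $\overline{\operatorname{ran}}\,\widehat F=D$. -/

import Mathlib

open scoped Pointwise

noncomputable section

/-- A mapping `F : S → X`, with `S ⊆ X`, is firmly nonexpansive if
`‖F x - F y‖² ≤ ⟪F x - F y, x - y⟫` for all `x, y ∈ S`. -/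
def FirmlyNonexpansive {X : Type*} [NormedAddCommGroup X] [InnerProductSpace ℝ X]
    {S : Set X} (F : S → X) : Prop :=
  ∀ x y : S, ‖F x - F y‖ ^ 2 ≤ inner ℝ (F x - F y) ((x : X) - (y : X))

/-- A set-valued operator `X ⇉ X'`. Addition and subtraction of such operators are pointwise
Minkowski addition and subtraction: `(A + B) x = {u + v | u ∈ A x, v ∈ B x}`. -/
abbrev SetOp (X X' : Type*) := X → Set X'

namespace SetOp

/-- The graph of a set-valued operator. -/
def gra {X X' : Type*} (A : SetOp X X') : Set (X × X') := {p | p.2 ∈ A p.1}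

/-- The inverse operator. -/
def inv {X X' : Type*} (A : SetOp X X') : SetOp X' X := fun y => {x | y ∈ A x}

/-- The identity, as a set-valued operator. -/
def Id (X : Type*) : SetOp X X := fun x => {x}

/-- A mapping `F : S → X'`, with `S ⊆ X`, as a set-valued operator on `X`; its value is the
singleton `{F x}` for `x ∈ S` and the empty set for `x ∉ S`. -/
def ofFun {X X' : Type*} {S : Set X} (F : S → X') : SetOp X X' :=
  fun x => {y | ∃ h : x ∈ S, F ⟨x, h⟩ = y}

/-- `A` is monotone: `⟪x - y, x* - y*⟫ ≥ 0` for all `(x, x*), (y, y*)` in the graph of `A`. -/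
def IsMonotone {X : Type*} [NormedAddCommGroup X] [InnerProductSpace ℝ X]
    (A : SetOp X X) : Prop :=
  ∀ p ∈ A.gra, ∀ q ∈ A.gra, 0 ≤ inner ℝ (p.1 - q.1) (p.2 - q.2)

/-- `B` extends `A`: the graph of `A` is contained in the graph of `B`. -/
def IsExtension {X X' : Type*} (B A : SetOp X X') : Prop := A.gra ⊆ B.gra

/-- `A` is maximal monotone: it is monotone, and its only monotone extension is `A` itself. -/
def IsMaximalMonotone {X : Type*} [NormedAddCommGroup X] [InnerProductSpace ℝ X]
    (A : SetOp X X) : Prop :=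
  A.IsMonotone ∧ ∀ A' : SetOp X X, A'.IsMonotone → A'.IsExtension A → A' = A

/-- The normal cone operator of a set `D`: `N_D x = {x* | ⟪d - x, x*⟫ ≤ 0 for all d ∈ D}` for
`x ∈ D`, and `N_D x = ∅` for `x ∉ D`. -/
def normalCone {X : Type*} [NormedAddCommGroup X] [InnerProductSpace ℝ X]
    (D : Set X) : SetOp X X :=
  fun x => {u | x ∈ D ∧ ∀ d ∈ D, inner ℝ (d - x) u ≤ 0}

/-- For `A : X ⇉ X` and a subspace `Y`, with `P` the orthogonal projector onto `Y`:
the composition `P A`, as an operator `Y ⇉ Y`, `y ↦ {P u | u ∈ A y}`. -/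
def projComp {X : Type*} [NormedAddCommGroup X] [InnerProductSpace ℝ X]
    (Y : Submodule ℝ X) [Y.HasOrthogonalProjection] (A : SetOp X X) : SetOp Y Y :=
  fun y => Y.orthogonalProjectionOnto '' A (y : X)

/-- For `B : Y ⇉ Y`, with `P` the orthogonal projector onto the subspace `Y`:
the composition `B P`, as an operator `X ⇉ X`, `x ↦ B (P x) ⊆ Y ⊆ X`. -/
def compProj {X : Type*} [NormedAddCommGroup X] [InnerProductSpace ℝ X]
    (Y : Submodule ℝ X) [Y.HasOrthogonalProjection] (B : SetOp Y Y) : SetOp X X :=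
  fun x => (Subtype.val : Y → X) '' B (Y.orthogonalProjectionOnto x)

end SetOp

end

open Filter Topology

/-! ### Maximal monotone operators and Minty's theorem -/

namespace SetOp

section Hilbert

variable {H : Type*} [NormedAddCommGroup H] [InnerProductSpace ℝ H]

/-! `Fhat` is the resolvent of `BP + N_D`. Monotonicity of `B` and of `N_D` makes it firmly
nonexpansive, hence at most single-valued; the substance is surjectivity of `Id + BP + N_D`. With
`C` the set `D` viewed in `Y`, a vector is normal to `D` exactly when its projection is normal to
`C`, so it suffices that `Id + B + N_C` is onto `Y`.

The domain of `B` contains `ran F`, and `0 ∈ ri D` puts `0` in the interior, within `Y`, of `conv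
(ran F)`. `exists_sub_mem_normalCone` replaces `N_C` by its Yosida regularization, solves by Minty's
theorem and a contraction, and passes to the limit; the interior point supplies the bounds.

`Fhat` extends `F` because `P(s - F s) ∈ B (F s)` while the rest of `s - F s` lies in `Yᗮ`, hence is
normal to `D`. The range of `Fhat` contains `D ∩ dom B`, whose density in `conv (ran F)` comes from
resolvents of `tB + N_C` with `t` small. -/

theorem IsMonotone.inner_nonneg {B : SetOp H H} (hB : B.IsMonotone) {y z u v : H}
    (hu : u ∈ B y) (hv : v ∈ B z) : 0 ≤ inner ℝ (y - z) (u - v) :=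
  hB (y, u) hu (z, v) hv

/-- A point monotonically related to a maximal monotone operator belongs to its graph. -/
theorem IsMaximalMonotone.mem_of_related {B : SetOp H H} (hB : B.IsMaximalMonotone) {y u : H}
    (h : ∀ z, ∀ v ∈ B z, 0 ≤ inner ℝ (y - z) (u - v)) : u ∈ B y := by
  have key := hB.2 (fun z => B z ∪ {v | z = y ∧ v = u}) ?_ ?_
  · rw [← key]
    exact Or.inr ⟨rfl, rfl⟩
  · rintro ⟨a, a'⟩ ha ⟨b, b'⟩ hb
    rcases ha with ha | ⟨ha, ha'⟩ <;> rcases hb with hb | ⟨hb, hb'⟩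
    · exact hB.1 (a, a') ha (b, b') hb
    · dsimp only at hb hb' ⊢
      subst hb hb'
      rw [← neg_sub b a, ← neg_sub b' a', inner_neg_neg]
      exact h a a' ha
    · dsimp only at ha ha' ⊢
      subst ha ha'
      exact h b b' hb
    · dsimp only at ha ha' hb hb' ⊢
      subst ha ha' hb hb'
      simp
  · rintro ⟨a, a'⟩ ha
    exact Or.inl ha

/-- This operator is `tB`; it turns Minty's theorem into solvability for every resolvent parameter.
-/
theorem IsMaximalMonotone.smul {B : SetOp H H} (hB : B.IsMaximalMonotone) {t : ℝ} (ht : 0 < t) :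
    IsMaximalMonotone (fun y => {u | t⁻¹ • u ∈ B y} : SetOp H H) := by
  constructor
  · rintro ⟨a, a'⟩ ha ⟨b, b'⟩ hb
    have := hB.1.inner_nonneg ha hb
    rw [← smul_sub, inner_smul_right] at this
    exact nonneg_of_mul_nonneg_right this (inv_pos.2 ht)
  · intro A' hA' hext
    funext y
    ext u
    refine ⟨fun hu => hB.mem_of_related fun z v hv => ?_, fun hu => hext (show (y, u) ∈ _ from hu)⟩
    have hv' : t • v ∈ A' z := by
      refine hext (show (z, t • v) ∈ _ from ?_)
      change t⁻¹ • t • v ∈ B z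
      rwa [inv_smul_smul₀ ht.ne']
    have := hA'.inner_nonneg hu hv'
    have h2 : t⁻¹ • u - v = t⁻¹ • (u - t • v) := by
      rw [smul_sub, inv_smul_smul₀ ht.ne']
    rw [h2, inner_smul_right]
    positivity

/-- Finitely many points of a monotone graph admit, up to `ε`, a common point related to them. -/
theorem IsMonotone.exists_approx_related {B : SetOp H H} (hB : B.IsMonotone) (x : H)
    {ι : Type*} [Fintype ι] (w v : ι → H) (hwv : ∀ i, v i ∈ B (w i)) {ε : ℝ} (hε : 0 < ε) :
    ∃ y : H, ∀ i, -ε < inner ℝ (w i - y) (v i - (x - y)) := by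
  classical
  by_contra hcon
  push Not at hcon
  let f : ι → H → ℝ := fun i y => inner ℝ (w i - y) (v i - (x - y))
  have hf : ∀ i y, f i y = inner ℝ (w i) (v i - x) + inner ℝ y (w i - v i + x) - inner ℝ y y := by
    intro i y
    simp only [f, inner_sub_left, inner_sub_right, inner_add_right]
    rw [real_inner_comm y (w i)]
    ring
  have hO : Convex ℝ {t : ι → ℝ | ∀ i, -ε < t i} := by
    have : {t : ι → ℝ | ∀ i, -ε < t i} = Set.univ.pi fun _ => Set.Ioi (-ε) := by
      ext t; simp
    rw [this]
    exact convex_pi fun i _ => convex_Ioi _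
  have hOo : IsOpen {t : ι → ℝ | ∀ i, -ε < t i} := by
    simp only [Set.ofPred_forall]
    exact isOpen_iInter_of_finite fun i => isOpen_lt continuous_const (continuous_apply i)
  -- Each `f i` is affine minus `‖y‖²`, hence concave. Separating this convex set from the open
  -- orthant yields weights `μ`.
  have hA : Convex ℝ {t : ι → ℝ | ∃ y, ∀ i, t i ≤ f i y} := by
    rintro t ⟨y, hy⟩ t' ⟨y', hy'⟩ a b ha hb hab
    refine ⟨a • y + b • y', fun i => ?_⟩
    have h1 := mul_le_mul_of_nonneg_left (hy i) ha
    have h2 := mul_le_mul_of_nonneg_left (hy' i) hb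
    have h3 : a * f i y + b * f i y' + a * b * inner ℝ (y - y') (y - y')
        = f i (a • y + b • y') := by
      obtain rfl : b = 1 - a := by linarith
      simp only [hf, inner_sub_left, inner_sub_right, inner_add_right, inner_add_left,
        inner_smul_left, inner_smul_right, real_inner_comm y y']
      simp
      ring
    have h4 : 0 ≤ a * b * inner ℝ (y - y') (y - y') :=
      mul_nonneg (mul_nonneg ha hb) real_inner_self_nonneg
    simp only [Pi.add_apply, Pi.smul_apply, smul_eq_mul]
    linarith
  have hdisj : Disjoint {t : ι → ℝ | ∀ i, -ε < t i} {t : ι → ℝ | ∃ y, ∀ i, t i ≤ f i y} := by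
    rw [Set.disjoint_left]
    rintro t ht ⟨y, hy⟩
    obtain ⟨i, hi⟩ := hcon y
    exact absurd ((ht i).trans_le (hy i)) (not_lt.2 hi)
  obtain ⟨φ, c, hφO, hφA⟩ := geometric_hahn_banach_open hO hOo hA hdisj
  let μ : ι → ℝ := fun i => -φ (Pi.single i 1)
  have hφ : ∀ t, φ t = -∑ i, μ i * t i := by
    intro t
    conv_lhs => rw [pi_eq_sum_univ' t]
    rw [map_sum, ← Finset.sum_neg_distrib]
    refine Finset.sum_congr rfl fun i _ => ?_
    simp [μ, mul_comm]
  have hc : 0 < c := by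
    have := hφO 0 (fun i => by simpa using hε)
    simpa using this
  have hμ : ∀ i, 0 ≤ μ i := by
    intro i
    by_contra hneg
    push Not at hneg
    -- At this point `φ` would equal `c`, which the strict separation forbids.
    have h1 := hφO (Pi.single i (c / (-μ i))) (fun j => ?_)
    · rw [hφ, Finset.sum_eq_single i (fun j _ hj => by simp [hj]) (by simp)] at h1
      rw [Pi.single_eq_same] at h1
      have : -(μ i * (c / -μ i)) = c := by
        have := hneg.ne
        field_simp
      linarith
    · rcases eq_or_ne j i with rfl | hj
      · rw [Pi.single_eq_same]
        have : 0 < c / -μ j := div_pos hc (by linarith)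
        linarith
      · simp [hj, hε]
  have hm : 0 < ∑ i, μ i := by
    refine lt_of_le_of_ne (Finset.sum_nonneg fun i _ => hμ i) fun h => ?_
    have hz := (Finset.sum_eq_zero_iff_of_nonneg fun i _ => hμ i).1 h.symm
    have := hφA (fun i => f i 0) ⟨0, fun i => le_rfl⟩
    rw [hφ, Finset.sum_eq_zero (fun i hi => by rw [hz i hi, zero_mul])] at this
    linarith
  set m := ∑ i, μ i with hmdef
  -- At the `μ`-barycentre the terms in `x - y` cancel; symmetrizing the rest gives a nonnegative
  -- double sum, against the separation.
  let y : H := m⁻¹ • ∑ j, μ j • w j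
  have hy : m • y = ∑ j, μ j • w j := by simp [y, smul_inv_smul₀ hm.ne']
  have h1 := hφA (fun i => f i y) ⟨y, fun i => le_rfl⟩
  rw [hφ] at h1
  have h0 : ∑ i, μ i • (w i - y) = 0 := by
    simp only [smul_sub, Finset.sum_sub_distrib]
    rw [← Finset.sum_smul, ← hy, sub_self]
  have h2 : ∑ i, μ i * f i y = ∑ i, μ i * inner ℝ (w i - y) (v i) := by
    have : inner ℝ (∑ i, μ i • (w i - y)) (x - y) = 0 := by rw [h0, inner_zero_left]
    rw [sum_inner] at this
    simp only [f, inner_sub_right _ _ (x - y), mul_sub, Finset.sum_sub_distrib]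
    simp only [real_inner_smul_left] at this
    rw [this, sub_zero]
  have h3 : 0 ≤ ∑ i, ∑ j, μ i * μ j * inner ℝ (w i - w j) (v i - v j) :=
    Finset.sum_nonneg fun i _ => Finset.sum_nonneg fun j _ =>
      mul_nonneg (mul_nonneg (hμ i) (hμ j)) (hB.inner_nonneg (hwv i) (hwv j))
  have h4 : ∑ i, ∑ j, μ i * μ j * inner ℝ (w i - w j) (v i - v j)
      = 2 * (m * ∑ i, μ i * inner ℝ (w i - y) (v i)) := by
    have e1 : ∀ i, ∑ j, μ i * μ j * inner ℝ (w i - w j) (v i)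
        = m * (μ i * inner ℝ (w i - y) (v i)) := by
      intro i
      have : ∑ j, μ j • (w i - w j) = m • (w i - y) := by
        simp only [smul_sub, Finset.sum_sub_distrib]
        rw [← Finset.sum_smul, ← hy]
      have h := congrArg (fun z => μ i * inner ℝ z (v i)) this
      simp only [sum_inner, real_inner_smul_left, Finset.mul_sum] at h
      rw [← mul_assoc, mul_comm m, mul_assoc, ← h]
      exact Finset.sum_congr rfl fun j _ => by ring
    have e2 : ∑ i, ∑ j, μ i * μ j * inner ℝ (w i - w j) (v j)
        = -∑ i, ∑ j, μ i * μ j * inner ℝ (w i - w j) (v i) := by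
      rw [Finset.sum_comm, ← Finset.sum_neg_distrib]
      refine Finset.sum_congr rfl fun i _ => ?_
      rw [← Finset.sum_neg_distrib]
      refine Finset.sum_congr rfl fun j _ => ?_
      rw [← neg_sub (w i) (w j), inner_neg_left]
      ring
    simp only [inner_sub_right, mul_sub, Finset.sum_sub_distrib]
    rw [e2, Finset.sum_congr rfl fun i _ => e1 i, ← Finset.mul_sum]
    ring
  rw [h4] at h3
  have h5 : 0 ≤ ∑ i, μ i * inner ℝ (w i - y) (v i) := by
    have := nonneg_of_mul_nonneg_right h3 two_pos
    exact nonneg_of_mul_nonneg_right this hm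
  rw [h2] at h1
  linarith

/-- **Minty's theorem**: `Id + B` is onto for `B` maximal monotone. -/
theorem IsMaximalMonotone.exists_sub_mem [FiniteDimensional ℝ H] {B : SetOp H H}
    (hB : B.IsMaximalMonotone) (x : H) : ∃ y, x - y ∈ B y := by
  classical
  -- Compact sets of approximate solutions. A finite subfamily is met by taking its smallest
  -- tolerance, so all of them share a point.
  let K : B.gra × {ε : ℝ // 0 < ε} → Set H := fun p =>
    {y | -(p.2 : ℝ) ≤ inner ℝ (p.1.1.1 - y) (p.1.1.2 - (x - y))}
  have hcl : ∀ p, IsClosed (K p) := fun p =>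
    isClosed_le continuous_const (by fun_prop)
  have hcpt : ∀ p, IsCompact (K p) := by
    intro p
    obtain ⟨⟨⟨w, v⟩, hwv⟩, ε, hε⟩ := p
    refine Metric.isCompact_of_isClosed_isBounded (hcl _) ?_
    rw [isBounded_iff_forall_norm_le]
    set a := ‖w - v + x‖
    set b := inner ℝ w (v - x) + ε
    refine ⟨a + |b| + 1, fun y hy => ?_⟩
    have h1 : -ε ≤ inner ℝ (w - y) (v - (x - y)) := hy
    have h2 : inner ℝ (w - y) (v - (x - y))
        = inner ℝ w (v - x) + inner ℝ y (w - v + x) - ‖y‖ ^ 2 := by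
      rw [← real_inner_self_eq_norm_sq]
      simp only [inner_sub_left, inner_sub_right, inner_add_right]
      rw [real_inner_comm y w]
      ring
    have h3 : inner ℝ y (w - v + x) ≤ ‖y‖ * a := real_inner_le_norm _ _
    have h4 := le_abs_self b
    have h5 : ‖y‖ ^ 2 ≤ ‖y‖ * a + |b| := by linarith
    have ha : 0 ≤ a := norm_nonneg _
    have hb := abs_nonneg b
    by_contra hlt
    push Not at hlt
    nlinarith [norm_nonneg y]
  by_cases hne : Nonempty B.gra
  · have : Nonempty (B.gra × {ε : ℝ // 0 < ε}) := ⟨hne.some, ⟨1, one_pos⟩⟩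
    obtain ⟨p₀⟩ := this
    obtain ⟨y, -, hy⟩ := (hcpt p₀).inter_iInter_nonempty K hcl (by
      intro s
      obtain ⟨y, hy⟩ : ∃ y, ∀ p ∈ insert p₀ s, y ∈ K p := by
        have hpos : ∃ ε : ℝ, 0 < ε ∧ ∀ p ∈ insert p₀ s, ε ≤ p.2 := by
          obtain ⟨q, hq, hmin⟩ := (insert p₀ s).exists_min_image (fun p => (p.2 : ℝ))
            ⟨p₀, Finset.mem_insert_self _ _⟩
          exact ⟨q.2, q.2.2, hmin⟩
        obtain ⟨ε, hε, hle⟩ := hpos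
        obtain ⟨y, hy⟩ := hB.1.exists_approx_related x
          (fun p : (insert p₀ s : Finset _) => p.1.1.1.1) (fun p => p.1.1.1.2)
          (fun p => p.1.1.2) hε
        refine ⟨y, fun p hp => ?_⟩
        have := hy ⟨p, hp⟩
        have h2 := hle p hp
        change -(p.2 : ℝ) ≤ _
        linarith
      exact ⟨y, hy p₀ (by simp), Set.mem_iInter₂.2 fun p hp => hy p (by simp [hp])⟩)
    refine ⟨y, hB.mem_of_related fun z v hv => ?_⟩
    refine le_of_forall_pos_le_add fun ε hε => ?_
    have h : -ε ≤ inner ℝ (z - y) (v - (x - y)) :=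
      Set.mem_iInter.1 hy (⟨(z, v), hv⟩, ⟨ε, hε⟩)
    rw [← neg_sub y z, ← neg_sub (x - y) v, inner_neg_neg] at h
    linarith
  · exact ⟨0, hB.mem_of_related fun z v hv => absurd ⟨⟨(z, v), hv⟩⟩ hne⟩

/-- The resolvent equation `x ∈ y + t B y` has a solution. -/
theorem IsMaximalMonotone.exists_smul_sub_mem [FiniteDimensional ℝ H] {B : SetOp H H}
    (hB : B.IsMaximalMonotone) {t : ℝ} (ht : 0 < t) (x : H) : ∃ y, t⁻¹ • (x - y) ∈ B y :=
  (hB.smul ht).exists_sub_mem x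

end Hilbert

end SetOp

/-! ### Projections and uniform bounds -/

/-- The variational inequality of the projection onto a closed convex set. -/
theorem exists_projection_inner_le_zero {H : Type*} [NormedAddCommGroup H] [InnerProductSpace ℝ H]
    [CompleteSpace H] {C : Set H} (hne : C.Nonempty) (hcl : IsClosed C) (hC : Convex ℝ C) (y : H) :
    ∃ p ∈ C, ∀ d ∈ C, inner ℝ (y - p) (d - p) ≤ 0 := by
  obtain ⟨p, hp, h⟩ := exists_norm_eq_iInf_of_complete_convex hne hcl.isComplete hC y
  exact ⟨p, hp, (norm_eq_iInf_iff_real_inner_le_zero hC hp).1 h⟩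

section Hilbert

variable {H : Type*} [NormedAddCommGroup H] [InnerProductSpace ℝ H]

theorem norm_le_norm_of_sq_le_inner {a b : H} (h : ‖a‖ ^ 2 ≤ inner ℝ a b) : ‖a‖ ≤ ‖b‖ := by
  have h1 := h.trans (real_inner_le_norm a b)
  rcases (norm_nonneg a).eq_or_lt with h0 | h0
  · rw [← h0]; exact norm_nonneg b
  · rw [sq] at h1
    exact le_of_mul_le_mul_left h1 h0

/-- A family of vectors whose inner products are bounded above at each point of a neighbourhood
of `0` is bounded. -/
theorem exists_norm_le_of_inner_le [CompleteSpace H] {ι : Type*} {u : ι → H} {U : Set H}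
    (hU : U ∈ 𝓝 (0 : H)) (h : ∀ d ∈ U, ∃ N : ℝ, ∀ i, inner ℝ d (u i) ≤ N) :
    ∃ M, ∀ i, ‖u i‖ ≤ M := by
  -- Small multiples of both `e` and `-e` lie in `U`, so the functionals are pointwise bounded and
  -- Banach–Steinhaus applies.
  have hb : ∀ e : H, ∃ M, ∀ i, ‖innerSL ℝ (u i) e‖ ≤ M := by
    intro e
    have hr : ∀ᶠ r in 𝓝 (0 : ℝ), r • e ∈ U ∧ (-r) • e ∈ U := by
      have c1 : Tendsto (fun r : ℝ => r • e) (𝓝 0) (𝓝 0) := by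
        have : Continuous fun r : ℝ => r • e := by fun_prop
        simpa using this.tendsto 0
      have c2 : Tendsto (fun r : ℝ => (-r) • e) (𝓝 0) (𝓝 0) := by
        have : Continuous fun r : ℝ => (-r) • e := by fun_prop
        simpa using this.tendsto 0
      exact (c1.eventually_mem hU).and (c2.eventually_mem hU)
    obtain ⟨r, ⟨h1, h2⟩, hr0⟩ :=
      ((hr.filter_mono nhdsWithin_le_nhds).and (self_mem_nhdsWithin (s := Set.Ioi (0 : ℝ)))).exists
    have hr0 : 0 < r := hr0
    obtain ⟨N1, hN1⟩ := h _ h1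
    obtain ⟨N2, hN2⟩ := h _ h2
    refine ⟨max N1 N2 / r, fun i => ?_⟩
    have a1 := (hN1 i).trans (le_max_left N1 N2)
    have a2 := (hN2 i).trans (le_max_right N1 N2)
    rw [real_inner_smul_left] at a1 a2
    rw [innerSL_apply_apply, real_inner_comm, Real.norm_eq_abs, le_div_iff₀ hr0]
    rcases abs_cases (inner ℝ e (u i)) with ⟨h, -⟩ | ⟨h, -⟩ <;> rw [h] <;> linarith
  obtain ⟨M, hM⟩ := banach_steinhaus hb
  exact ⟨M, fun i => by simpa using hM i⟩

/-! ### Adding a normal cone -/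

namespace SetOp

/-- Points of the convex hull of the domain of a monotone operator satisfy an affine minorization. -/
theorem IsMonotone.exists_affine_le {B : SetOp H H} (hB : B.IsMonotone) {R : Set H}
    (hR : ∀ w ∈ R, (B w).Nonempty) {z : H} (hz : z ∈ convexHull ℝ R) :
    ∃ (v : H) (c : ℝ), ∀ y, ∀ u ∈ B y, inner ℝ y v + c ≤ inner ℝ (y - z) u := by
  refine convexHull_min (t := {z | ∃ (v : H) (c : ℝ), ∀ y, ∀ u ∈ B y,
    inner ℝ y v + c ≤ inner ℝ (y - z) u}) ?_ ?_ hz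
  · intro w hw
    obtain ⟨v, hv⟩ := hR w hw
    refine ⟨v, -inner ℝ w v, fun y u hu => ?_⟩
    have := hB.inner_nonneg hu hv
    rw [inner_sub_right, inner_sub_left y w v] at this
    linarith
  · rintro z ⟨v, c, h⟩ z' ⟨v', c', h'⟩ a b ha hb hab
    refine ⟨a • v + b • v', a * c + b * c', fun y u hu => ?_⟩
    have h1 := mul_le_mul_of_nonneg_left (h y u hu) ha
    have h2 := mul_le_mul_of_nonneg_left (h' y u hu) hb
    have h3 : y - (a • z + b • z') = a • (y - z) + b • (y - z') := by
      rw [smul_sub, smul_sub, sub_add_sub_comm, ← add_smul, hab, one_smul]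
    rw [h3, inner_add_left, inner_add_right]
    simp only [real_inner_smul_left, real_inner_smul_right]
    linarith

variable [FiniteDimensional ℝ H]

/-- Solvability of `x ∈ y + B y + s (y - P_C y)`, where `s (y - P_C y)` is the Moreau–Yosida
regularization of the normal cone operator of `C`. -/
theorem IsMaximalMonotone.exists_regularized_mem {B : SetOp H H} (hB : B.IsMaximalMonotone)
    {C : Set H} (hne : C.Nonempty) (hcl : IsClosed C) (hC : Convex ℝ C) (x : H) {s : ℝ}
    (hs : 0 < s) :
    ∃ y, ∃ p ∈ C, (∀ d ∈ C, inner ℝ (y - p) (d - p) ≤ 0) ∧ x - y - s • (y - p) ∈ B y := by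
  -- The inclusion reads `y = J ((1 + s)⁻¹ (x + s P y))`, with `J` the resolvent of parameter `(1 +
  -- s)⁻¹`: a contraction of factor `s / (1 + s)`.
  have ht : 0 < (1 + s)⁻¹ := by positivity
  choose J hJ using hB.exists_smul_sub_mem ht
  choose P hPC hP using exists_projection_inner_le_zero hne hcl hC
  have hJn : ∀ z z', ‖J z - J z'‖ ≤ ‖z - z'‖ := by
    intro z z'
    apply norm_le_norm_of_sq_le_inner
    have := hB.1.inner_nonneg (hJ z) (hJ z')
    rw [← smul_sub, real_inner_smul_right] at this
    have := nonneg_of_mul_nonneg_right this (inv_pos.2 ht)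
    rw [sub_sub_sub_comm, inner_sub_right, real_inner_self_eq_norm_sq] at this
    linarith
  have hPn : ∀ z z', ‖P z - P z'‖ ≤ ‖z - z'‖ := by
    intro z z'
    apply norm_le_norm_of_sq_le_inner
    have h1 := hP z (P z') (hPC z')
    have h2 := hP z' (P z) (hPC z)
    rw [← neg_sub (P z) (P z'), inner_neg_right] at h1
    have h3 : inner ℝ (P z - P z') (P z - P z') = inner ℝ (P z - P z') (z - z')
        - inner ℝ (z - P z) (P z - P z') + inner ℝ (z' - P z') (P z - P z') := by
      rw [real_inner_comm (P z - P z') (z - P z), real_inner_comm (P z - P z') (z' - P z'),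
        ← inner_sub_right, ← inner_add_right]
      congr 1
      abel
    rw [← real_inner_self_eq_norm_sq]
    linarith
  let T : H → H := fun y => J ((1 + s)⁻¹ • (x + s • P y))
  have hT : ContractingWith (Real.toNNReal ((1 + s)⁻¹ * s)) T := by
    refine ⟨?_, LipschitzWith.of_dist_le_mul fun y y' => ?_⟩
    · rw [Real.toNNReal_lt_one, inv_mul_lt_one₀ (by positivity)]
      linarith
    · rw [Real.coe_toNNReal _ (by positivity), dist_eq_norm, dist_eq_norm]
      refine (hJn _ _).trans ?_
      rw [← smul_sub, add_sub_add_left_eq_sub, ← smul_sub, smul_smul, norm_smul, Real.norm_eq_abs,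
        abs_of_pos (by positivity)]
      gcongr
      exact hPn _ _
  refine ⟨hT.fixedPoint, P hT.fixedPoint, hPC _, hP _, ?_⟩
  have hfix : T hT.fixedPoint = hT.fixedPoint := hT.fixedPoint_isFixedPt
  have h := hJ ((1 + s)⁻¹ • (x + s • P hT.fixedPoint))
  change _ ∈ B (T hT.fixedPoint) at h
  change _ • (_ - T hT.fixedPoint) ∈ _ at h
  rw [hfix] at h
  convert h using 1
  rw [inv_inv, smul_sub _ (_ • _), smul_inv_smul₀ (by positivity)]
  module

/-- `Id + B + N_C` is onto when `0` is interior to the convex hull of a part of the domain of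
`B` that lies in `C`. -/
theorem IsMaximalMonotone.exists_sub_mem_normalCone {B : SetOp H H} (hB : B.IsMaximalMonotone)
    {R C : Set H} (hR : ∀ w ∈ R, (B w).Nonempty) (hRC : convexHull ℝ R ⊆ C) (hcl : IsClosed C)
    (hC : Convex ℝ C) (h0 : (0 : H) ∈ interior (convexHull ℝ R)) (x : H) :
    ∃ y, ∃ u ∈ B y, x - y - u ∈ normalCone C y := by
  have h0C : (0 : H) ∈ C := hRC (interior_subset h0)
  choose y p hpC hp hu using fun k : ℕ =>
    hB.exists_regularized_mem ⟨0, h0C⟩ hcl hC x (Nat.cast_add_one_pos (α := ℝ) k)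
  let n : ℕ → H := fun k => ((k : ℝ) + 1) • (y k - p k)
  let u : ℕ → H := fun k => x - y k - n k
  have hu : ∀ k, u k ∈ B (y k) := hu
  have hn : ∀ k, ∀ d ∈ C, 0 ≤ inner ℝ (p k - d) (n k) := by
    intro k d hd
    have := hp k d hd
    rw [real_inner_comm, ← neg_sub, inner_neg_left] at this
    rw [real_inner_smul_right]
    have hk : (0 : ℝ) < k + 1 := Nat.cast_add_one_pos k
    exact mul_nonneg hk.le (by linarith)
  have hyn : ∀ k, ∀ d ∈ C, 0 ≤ inner ℝ (y k - d) (n k) := by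
    intro k d hd
    have h1 : 0 ≤ inner ℝ (y k - p k) (n k) := by
      rw [real_inner_smul_right]
      have hk : (0 : ℝ) < k + 1 := Nat.cast_add_one_pos k
      exact mul_nonneg hk.le real_inner_self_nonneg
    have h2 := hn k d hd
    rw [← sub_add_sub_cancel (y k) (p k) d, inner_add_left]
    linarith
  have hxy : ∀ k, x - y k = u k + n k := fun k => by simp [u]
  obtain ⟨v₀, c₀, h₀⟩ := hB.1.exists_affine_le hR (interior_subset h0)
  have hsum : ∀ k, inner ℝ (y k) (u k) + inner ℝ (y k) (n k)
      = inner ℝ (y k) x - ‖y k‖ ^ 2 := by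
    intro k
    rw [← inner_add_right, ← hxy, inner_sub_right, real_inner_self_eq_norm_sq]
  have hyu0 : ∀ k, inner ℝ (y k) v₀ + c₀ ≤ inner ℝ (y k) (u k) := fun k => by
    simpa using h₀ (y k) (u k) (hu k)
  have hyn0 : ∀ k, 0 ≤ inner ℝ (y k) (n k) := fun k => by simpa using hyn k 0 h0C
  -- `‖y‖² ≤ ⟪y, x⟫ - ⟪y, v₀⟫ - c₀`: quadratic against linear.
  obtain ⟨My, hMy⟩ : ∃ M, ∀ k, ‖y k‖ ≤ M := by
    refine ⟨‖x‖ + ‖v₀‖ + |c₀| + 1, fun k => ?_⟩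
    have h1 := hsum k
    have h2 := hyu0 k
    have h3 := hyn0 k
    have h4 := real_inner_le_norm (y k) x
    have h5 := neg_le_of_abs_le (abs_real_inner_le_norm (y k) v₀)
    have h6 := neg_abs_le c₀
    by_contra hlt
    push Not at hlt
    nlinarith [norm_nonneg (y k), norm_nonneg x, norm_nonneg v₀, abs_nonneg c₀]
  have hMy0 : 0 ≤ My := (norm_nonneg _).trans (hMy 0)
  have hinner : ∀ (a : H) k, |inner ℝ (y k) a| ≤ My * ‖a‖ := fun a k =>
    (abs_real_inner_le_norm _ _).trans (mul_le_mul_of_nonneg_right (hMy k) (norm_nonneg a))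
  have hnhds : convexHull ℝ R ∈ 𝓝 (0 : H) := mem_interior_iff_mem_nhds.1 h0
  -- The minorization at each `d` near `0` bounds `⟪d, u k⟫` above.
  obtain ⟨Mu, hMu⟩ : ∃ M, ∀ k, ‖u k‖ ≤ M := by
    refine exists_norm_le_of_inner_le hnhds fun d hd => ?_
    obtain ⟨v, c, h⟩ := hB.1.exists_affine_le hR hd
    refine ⟨My * ‖x‖ + My * ‖v‖ - c, fun k => ?_⟩
    have h1 := h (y k) (u k) (hu k)
    rw [inner_sub_left] at h1
    have h2 := le_of_abs_le (hinner x k)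
    have h3 := neg_le_of_abs_le (hinner v k)
    have h4 := hsum k
    have h5 := hyn0 k
    have h6 := sq_nonneg ‖y k‖
    linarith
  obtain ⟨Mn, hMn⟩ : ∃ M, ∀ k, ‖n k‖ ≤ M := by
    refine ⟨‖x‖ + My + Mu, fun k => ?_⟩
    have h1 : n k = x - y k - u k := by simp [u]
    rw [h1]
    refine (norm_sub_le _ _).trans (add_le_add ((norm_sub_le _ _).trans ?_) (hMu k))
    exact add_le_add le_rfl (hMy k)
  obtain ⟨⟨y', n'⟩, -, φ, hφ, hlim⟩ := tendsto_subseq_of_bounded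
    (Metric.isBounded_closedBall (x := (0 : H)) (r := My) |>.prod
      (Metric.isBounded_closedBall (x := (0 : H)) (r := Mn)))
    (x := fun k => (y k, n k)) (fun k => by simpa using ⟨hMy k, hMn k⟩)
  have hy' : Tendsto (fun k => y (φ k)) atTop (𝓝 y') := (continuous_fst.tendsto _).comp hlim
  have hn' : Tendsto (fun k => n (φ k)) atTop (𝓝 n') := (continuous_snd.tendsto _).comp hlim
  have hu' : Tendsto (fun k => u (φ k)) atTop (𝓝 (x - y' - n')) :=
    (tendsto_const_nhds.sub hy').sub hn'
  -- `p = y - n / (k + 1)` with `n` bounded, so the limit of `y` lies in `C`.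
  have hp' : Tendsto (fun k => p (φ k)) atTop (𝓝 y') := by
    have hinv : Tendsto (fun k => (1 : ℝ) / ((φ k : ℝ) + 1)) atTop (𝓝 0) :=
      tendsto_one_div_add_atTop_nhds_zero_nat.comp hφ.tendsto_atTop
    have := hy'.sub (hinv.smul hn')
    rw [zero_smul, sub_zero] at this
    refine this.congr fun k => ?_
    have hk : ((φ k : ℝ) + 1) ≠ 0 := (Nat.cast_add_one_pos _).ne'
    simp only [n]
    rw [one_div, inv_smul_smul₀ hk, sub_sub_cancel]
  refine ⟨y', x - y' - n', hB.mem_of_related fun z v hv => ?_, ?_⟩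
  · exact ge_of_tendsto' ((hy'.sub tendsto_const_nhds).inner (hu'.sub tendsto_const_nhds))
      fun k => hB.1.inner_nonneg (hu (φ k)) hv
  · rw [sub_sub_cancel]
    refine ⟨hcl.mem_of_tendsto hp' (Eventually.of_forall fun k => hpC _), fun d hd => ?_⟩
    have := ge_of_tendsto' ((hp'.sub tendsto_const_nhds).inner hn') fun k => hn (φ k) d hd
    rw [← neg_sub, inner_neg_left]
    linarith

/-- Under the same condition, the domain of `B + N_C` is dense in the convex hull. -/
theorem IsMaximalMonotone.convexHull_subset_closure_dom {B : SetOp H H} (hB : B.IsMaximalMonotone)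
    {R C : Set H} (hR : ∀ w ∈ R, (B w).Nonempty) (hRC : convexHull ℝ R ⊆ C) (hcl : IsClosed C)
    (hC : Convex ℝ C) (h0 : (0 : H) ∈ interior (convexHull ℝ R)) :
    convexHull ℝ R ⊆ closure {y ∈ C | (B y).Nonempty} := by
  intro z hz
  obtain ⟨v, c, h⟩ := hB.1.exists_affine_le hR hz
  rw [Metric.mem_closure_iff]
  intro ε hε
  set M := |inner ℝ z v + c|
  have hM : 0 ≤ M := abs_nonneg _
  have hQ : 0 < ‖v‖ + M / ε + 1 := by positivity
  -- Chosen so that `t (‖v‖ + M / ε) < ε`. If `q ≥ ε`, then `M ≤ q (M / ε)`, and `q² ≤ t (q ‖v‖ +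
  -- M)` forces `q < ε`.
  set t := ε / (2 * (‖v‖ + M / ε + 1)) with htdef
  have ht : 0 < t := by positivity
  obtain ⟨y, u, hu, hyC, hy⟩ :=
    (hB.smul ht).exists_sub_mem_normalCone (R := R)
      (fun w hw => (hR w hw).elim fun v hv => ⟨t • v, by
        change t⁻¹ • t • v ∈ B w
        rwa [inv_smul_smul₀ ht.ne']⟩) hRC hcl hC h0 z
  refine ⟨y, ⟨hyC, _, hu⟩, ?_⟩
  have h1 := hy z (hRC hz)
  have h2 := h y (t⁻¹ • u) hu
  rw [← neg_sub z y, inner_neg_left, real_inner_smul_right] at h2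
  rw [inner_sub_right, real_inner_self_eq_norm_sq] at h1
  rw [dist_eq_norm]
  set q := ‖z - y‖ with hq
  have h3 : inner ℝ (z - y) u ≤ t * (-(inner ℝ y v + c)) := by
    have : t⁻¹ * inner ℝ (z - y) u ≤ -(inner ℝ y v + c) := by linarith
    rwa [inv_mul_le_iff₀ ht] at this
  have h4 : -(inner ℝ y v + c) ≤ q * ‖v‖ + M := by
    have e : -(inner ℝ y v + c) = inner ℝ (z - y) v - (inner ℝ z v + c) := by
      rw [inner_sub_left]; ring
    have := real_inner_le_norm (z - y) v
    have := neg_abs_le (inner ℝ z v + c)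
    rw [e]
    linarith
  have h5 : q ^ 2 ≤ t * (q * ‖v‖ + M) := by
    have := mul_le_mul_of_nonneg_left h4 ht.le
    linarith
  by_contra hlt
  push Not at hlt
  have hqpos : 0 < q := hε.trans_le hlt
  have h6 : M ≤ q * (M / ε) := by
    have : ε * (M / ε) = M := by field_simp
    calc M = ε * (M / ε) := this.symm
      _ ≤ q * (M / ε) := by gcongr
  have h7 : q ^ 2 ≤ q * (t * (‖v‖ + M / ε)) := by
    have : t * (q * ‖v‖ + M) ≤ t * (q * ‖v‖ + q * (M / ε)) := by gcongr
    linarith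
  have h8 : q ≤ t * (‖v‖ + M / ε) := by
    rw [sq] at h7
    exact le_of_mul_le_mul_left h7 hqpos
  have h9 : t * (‖v‖ + M / ε + 1) = ε / 2 := by
    rw [htdef]; field_simp
  linarith

end SetOp

end Hilbert

/-! ### Relative interiors -/

/-- In finite dimension, a point interior to the closure of a convex set is interior to the
set itself. -/
theorem Convex.mem_interior_of_mem_interior_closure {H : Type*} [NormedAddCommGroup H]
    [NormedSpace ℝ H] [FiniteDimensional ℝ H] {K : Set H} (hK : Convex ℝ K) {z : H}
    (hz : z ∈ interior (closure K)) : z ∈ interior K := by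
  have hne : (interior K).Nonempty := by
    rw [hK.interior_nonempty_iff_affineSpan_eq_top, eq_top_iff]
    have hcl : IsClosed (affineSpan ℝ K : Set H) := AffineSubspace.closed_of_finiteDimensional _
    have hsub : closure K ⊆ affineSpan ℝ K := hcl.closure_subset_iff.2 (subset_affineSpan ℝ K)
    have htop : affineSpan ℝ (closure K) = ⊤ :=
      hK.closure.interior_nonempty_iff_affineSpan_eq_top.1 ⟨z, hz⟩
    rw [← htop]
    exact affineSpan_le.2 hsub
  rwa [hK.interior_closure_eq_interior_of_nonempty_interior hne] at hz

/-- If `0` is in the relative interior of `D`, then it is an interior point of `D` within the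
span of `D`. -/
theorem zero_mem_interior_preimage_span {X : Type*} [NormedAddCommGroup X] [NormedSpace ℝ X]
    {D : Set X} (h0 : (0 : X) ∈ intrinsicInterior ℝ D) :
    (0 : Submodule.span ℝ D) ∈ interior ((↑) ⁻¹' D : Set (Submodule.span ℝ D)) := by
  have h0D : (0 : X) ∈ D := intrinsicInterior_subset h0
  obtain ⟨a, ha, ha0⟩ := mem_intrinsicInterior.1 h0
  -- Since `0 ∈ D`, the affine and linear spans of `D` coincide.
  have hle : ∀ w : Submodule.span ℝ D, (w : X) ∈ affineSpan ℝ D := by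
    intro w
    have h := affineSpan_insert_zero (k := ℝ) D
    rw [Set.insert_eq_of_mem h0D] at h
    rw [← SetLike.mem_coe, h]
    exact w.2
  let g : Submodule.span ℝ D → affineSpan ℝ D := fun w => ⟨w, hle w⟩
  have hg : Continuous g := continuous_subtype_val.subtype_mk _
  have hg0 : g 0 = a := Subtype.ext (by simp [g, ha0])
  rw [mem_interior_iff_mem_nhds] at ha ⊢
  rw [← hg0] at ha
  exact hg.continuousAt ha

/-! ### Transfer from `Y` to `X` -/

theorem theorem3p5 {X : Type*} [NormedAddCommGroup X] [InnerProductSpace ℝ X]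
    [FiniteDimensional ℝ X]
    (S : Set X) (F : S → X) (hF : FirmlyNonexpansive F)
    (D : Set X) (hD : D = closure (convexHull ℝ (Set.range F)))
    (Y : Submodule ℝ X) (hY : Y = Submodule.span ℝ D)
    (h0 : (0 : X) ∈ intrinsicInterior ℝ D)
    (B : SetOp Y Y) (hB : B.IsMaximalMonotone)
    (hBext : B.IsExtension (SetOp.projComp Y ((SetOp.ofFun F).inv - SetOp.Id X)))
    (Bhat : SetOp X X) (hBhat : Bhat = SetOp.compProj Y B + SetOp.normalCone D)
    (Fhat : SetOp X X) (hFhat : Fhat = (SetOp.Id X + Bhat).inv) :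
    ∃ G : X → X,
      (∀ x : X, Fhat x = {G x}) ∧
      FirmlyNonexpansive (Set.univ.domRestrict G) ∧
      (∀ x : S, G x = F x) ∧
      closure (Set.range G) = D := by
  have hDY : ∀ d ∈ D, d ∈ Y := fun d hd => hY ▸ Submodule.subset_span hd
  have hFD : ∀ s, F s ∈ D := fun s =>
    hD ▸ subset_closure (subset_convexHull ℝ _ (Set.mem_range_self s))
  have hDcl : IsClosed D := hD ▸ isClosed_closure
  have hDcv : Convex ℝ D := hD ▸ (convex_convexHull ℝ _).closure
  let R : Set Y := {w | (w : X) ∈ Set.range F}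
  let C : Set Y := (↑) ⁻¹' D
  have hCcl : IsClosed C := hDcl.preimage continuous_subtype_val
  have hCcv : Convex ℝ C := hDcv.linear_preimage Y.subtype
  have hRC : convexHull ℝ R ⊆ C := by
    refine convexHull_min ?_ hCcv
    rintro w ⟨s, hs⟩
    change (w : X) ∈ D
    exact hs ▸ hFD s
  have hCD : (Y.subtype '' C) = D := by
    ext d
    exact ⟨by rintro ⟨w, hw, rfl⟩; exact hw, fun hd => ⟨⟨d, hDY d hd⟩, hd, rfl⟩⟩
  have hRF : Y.subtype '' convexHull ℝ R = convexHull ℝ (Set.range F) := by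
    rw [LinearMap.image_convexHull]
    congr 1
    ext d
    refine ⟨by rintro ⟨w, hw, rfl⟩; exact hw, fun hd => ⟨⟨d, hDY d ?_⟩, hd, rfl⟩⟩
    obtain ⟨s, rfl⟩ := hd
    exact hFD s
  have hemb : Topology.IsClosedEmbedding (Y.subtype : Y → X) :=
    (Submodule.closed_of_finiteDimensional Y).isClosedEmbedding_subtypeVal
  have hCR : C = closure (convexHull ℝ R) := by
    apply Set.image_injective.2 Y.subtype_injective
    rw [hCD, ← hemb.closure_image_eq, hRF, hD]
  have h0R : (0 : Y) ∈ interior (convexHull ℝ R) := by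
    apply (convex_convexHull ℝ R).mem_interior_of_mem_interior_closure
    rw [← hCR]
    subst hY
    exact zero_mem_interior_preimage_span h0
  have hFB : ∀ (s : S) (w : Y), F s = w → Y.orthogonalProjectionOnto ((s : X) - w) ∈ B w := by
    intro s w hs
    refine hBext (show (w, _) ∈ _ from ⟨(s : X) - w, ?_, rfl⟩)
    exact Set.sub_mem_sub ⟨s.2, hs⟩ rfl
  have hR : ∀ w ∈ R, (B w).Nonempty := by
    rintro w ⟨s, hs⟩
    exact ⟨_, hFB s w hs⟩
  have hmem : ∀ x y, y ∈ Fhat x ↔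
      ∃ u ∈ B (Y.orthogonalProjectionOnto y), x - y - (u : X) ∈ SetOp.normalCone D y := by
    intro x y
    subst hFhat hBhat
    constructor
    · rintro ⟨_, rfl, _, ⟨_, ⟨u, hu, rfl⟩, n, hn, rfl⟩, hx⟩
      refine ⟨u, hu, ?_⟩
      convert hn using 1
      rw [← hx]
      simp
    · rintro ⟨u, hu, hn⟩
      exact ⟨y, rfl, _, ⟨_, ⟨u, hu, rfl⟩, _, hn, rfl⟩, by simp⟩
  have hproj : ∀ y ∈ D, (Y.orthogonalProjectionOnto y : X) = y := fun y hy =>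
    Submodule.starProjection_eq_self_iff.2 (hDY y hy)
  have hinner : ∀ (x : X) (w : Y), inner ℝ (w : X) x = inner ℝ w (Y.orthogonalProjectionOnto x) :=
    fun x w => (Submodule.inner_orthogonalProjectionOnto_eq_of_mem_left w x).symm
  -- Differences of points of `D` lie in `Y`, so they only see the projection of `x`.
  have hcone : ∀ (w : Y) (x : X), x ∈ SetOp.normalCone D (w : X) ↔
      Y.orthogonalProjectionOnto x ∈ SetOp.normalCone C w := by
    intro w x
    refine and_congr Iff.rfl ⟨fun h d hd => ?_, fun h d hd => ?_⟩
    · rw [← hinner]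
      exact h d hd
    · have := h ⟨d, hDY d hd⟩ hd
      rwa [← hinner] at this
  have hfirm : ∀ x x' y y', y ∈ Fhat x → y' ∈ Fhat x' →
      ‖y - y'‖ ^ 2 ≤ inner ℝ (y - y') (x - x') := by
    intro x x' y y' hy hy'
    obtain ⟨u, hu, hyD, hn⟩ := (hmem x y).1 hy
    obtain ⟨u', hu', hyD', hn'⟩ := (hmem x' y').1 hy'
    have h1 := hB.1.inner_nonneg hu hu'
    rw [Submodule.coe_inner, Submodule.coe_sub, Submodule.coe_sub, hproj y hyD,
      hproj y' hyD'] at h1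
    have h2 := hn y' hyD'
    have h3 := hn' y hyD
    rw [← neg_sub y y', inner_neg_left] at h2
    have h4 : inner ℝ (y - y') (x - x') = inner ℝ (y - y') (y - y')
        + inner ℝ (y - y') ((u : X) - u') + inner ℝ (y - y') (x - y - u)
        - inner ℝ (y - y') (x' - y' - u') := by
      rw [← inner_add_right, ← inner_add_right, ← inner_sub_right]
      congr 1
      abel
    rw [h4, real_inner_self_eq_norm_sq]
    linarith
  have huniq : ∀ x y y', y ∈ Fhat x → y' ∈ Fhat x → y = y' := by
    intro x y y' hy hy'
    have := hfirm x x y y' hy hy'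
    rw [sub_self, inner_zero_right] at this
    exact sub_eq_zero.1 (norm_eq_zero.1 (pow_eq_zero_iff two_ne_zero |>.1
      (le_antisymm this (sq_nonneg _))))
  have hex : ∀ x, ∃ y, y ∈ Fhat x := by
    intro x
    obtain ⟨y, u, hu, hn⟩ := hB.exists_sub_mem_normalCone hR hRC hCcl hCcv h0R
      (Y.orthogonalProjectionOnto x)
    refine ⟨y, (hmem x y).2 ⟨u, by simpa using hu, (hcone _ _).2 ?_⟩⟩
    simpa using hn
  choose G hG using hex
  have hGD : ∀ x, G x ∈ D := fun x =>
    ((hmem x (G x)).1 (hG x)).elim fun u h => h.2.1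
  refine ⟨G, fun x => ?_, fun x y => hfirm x y _ _ (hG x) (hG y), fun s => ?_, ?_⟩
  · exact Set.eq_singleton_iff_unique_mem.2 ⟨hG x, fun y hy => huniq x y _ hy (hG x)⟩
  · refine huniq s _ _ (hG s) ((hmem _ _).2 ?_)
    refine ⟨_, hFB s (Y.orthogonalProjectionOnto (F s)) (hproj _ (hFD s)).symm, ?_⟩
    rw [hproj _ (hFD s)]
    have := (hcone ⟨F s, hDY _ (hFD s)⟩
      (s - F s - (Y.orthogonalProjectionOnto ((s : X) - F s) : X))).2 ?_
    · exact this
    · rw [map_sub, Submodule.orthogonalProjectionOnto_mem_subspace_eq_self, sub_self]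
      exact ⟨hFD s, fun d _ => by simp⟩
  · refine Set.Subset.antisymm (closure_minimal (Set.range_subset_iff.2 hGD) hDcl) ?_
    have hdom : Y.subtype '' {y ∈ C | (B y).Nonempty} ⊆ Set.range G := by
      rintro _ ⟨y, ⟨hyC, u, hu⟩, rfl⟩
      -- `y` solves the resolvent inclusion at `y + u` with normal component `0`.
      refine ⟨(y : X) + u, huniq _ _ _ (hG _) ((hmem _ _).2 ⟨u, by simpa using hu, ?_⟩)⟩
      simpa using ⟨hyC, fun d _ => by simp⟩
    have h1 : C ⊆ closure {y ∈ C | (B y).Nonempty} := by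
      conv_lhs => rw [hCR]
      exact closure_minimal (hB.convexHull_subset_closure_dom hR hRC hCcl hCcv h0R) isClosed_closure
    calc D = Y.subtype '' C := hCD.symm
      _ ⊆ Y.subtype '' closure {y ∈ C | (B y).Nonempty} := Set.image_mono h1
      _ ⊆ closure (Y.subtype '' {y ∈ C | (B y).Nonempty}) :=
        image_closure_subset_closure_image continuous_subtype_val
      _ ⊆ closure (Set.range G) := closure_mono hdom
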